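/- Identify a set $S\subseteq\omega$ with its characteristic function. A set $A\subseteq\omega$ is *1-generic* if for every c.e. set $W\subseteq 2^{<\omega}$ there is an initial segment $\sigma$ of $A$ such that either $\sigma\in W$ or no $\tau\in 2^{<\omega}$ extending $\sigma$ belongs to $W$. A set $X\subseteq\omega$ is a *union set for 1-genericity* if $G\cup X$ is 1-generic for every 1-generic $G$. A set is *immune* if it is infinite and has no infinite c.e. subset. A set $X$ is *hyperimmune* if it is infinite and there is no computable sequence $(F_n)_{n\in\omega}$ of pairwise disjoint finite sets, each given explicitly by the list of its elements, with $F_n\cap X\neq\emptyset$ for all $n$. Let $\emptyset'$ be the halting problem. Then: 1. For every infinite set $X\subseteq\omega$ there is a 1-generic set $A$ such that $A\cup X$ is not 1-generic. 2. That is, there is no infinite union set for 1-genericity. 3. Every finite set $X\subseteq\omega$ is a union set for 1-genericity. 4. If $X$ is immune and $\omega\setminus X$ is not hyperimmune, then there is a 1-generic set $A$ such that $A\cup X\geq_T\emptyset'$ and $A\cup X$ is not 1-generic. -/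

import Mathlib

namespace Genericity

/-- The binary string `σ` is an initial segment of (the characteristic function of) `A`. -/
def IsInitialSegment (σ : List Bool) (A : Set ℕ) : Prop :=
  ∀ (i : ℕ) (hi : i < σ.length), σ[i] = true ↔ i ∈ A

/-- `A` is 1-generic: for every c.e. set `W` of binary strings, some initial segment `σ` of `A`
either belongs to `W` or has no extension in `W`. -/
def OneGeneric (A : Set ℕ) : Prop :=
  ∀ W : Set (List Bool), REPred (fun τ : List Bool => τ ∈ W) →
    ∃ σ : List Bool, IsInitialSegment σ A ∧ (σ ∈ W ∨ ∀ τ : List Bool, σ <+: τ → τ ∉ W)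

/-- `X` is a union set for 1-genericity. -/
def IsUnionSet (X : Set ℕ) : Prop :=
  ∀ G : Set ℕ, OneGeneric G → OneGeneric (G ∪ X)

/-- `X` is immune: infinite, without an infinite c.e. subset. -/
def Immune (X : Set ℕ) : Prop :=
  X.Infinite ∧ ∀ W : Set ℕ, REPred (fun n : ℕ => n ∈ W) → W.Infinite → ¬ W ⊆ X

/-- A disjoint strong array: a computable sequence of pairwise disjoint finite sets, the `n`-th of
which is given explicitly, as the list `F n` of its elements. -/
def IsDisjointStrongArray (F : ℕ → List ℕ) : Prop :=
  Computable F ∧ ∀ m n : ℕ, m ≠ n → List.Disjoint (F m) (F n)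

/-- `X` is hyperimmune: infinite, and no disjoint strong array has all its members meeting `X`. -/
def Hyperimmune (X : Set ℕ) : Prop :=
  X.Infinite ∧ ¬ ∃ F : ℕ → List ℕ, IsDisjointStrongArray F ∧ ∀ n : ℕ, ∃ x ∈ F n, x ∈ X

/-- The characteristic function of `S`, as a (total) partial function. -/
noncomputable def charFun (S : Set ℕ) : ℕ →. ℕ :=
  fun n => Part.some (S.indicator (fun _ => 1) n)

/-- Turing reducibility of sets of natural numbers: `S` is computable from `T`. -/
def SetTuringReducible (S T : Set ℕ) : Prop :=
  TuringReducible (charFun S) (charFun T)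

/-- The halting problem: the set of `e` such that the `e`-th partial computable function
halts on input `e`. -/
def haltingSet : Set ℕ :=
  {e | ((Denumerable.ofNat Nat.Partrec.Code e).eval e).Dom}

end Genericity

/-!
Let `X` be infinite. If `X` has an infinite c.e. subset, then so has every `A ∪ X`, and a set with
an infinite c.e. subset is not 1-generic (`not_oneGeneric_of_infinite_subset`).

If `X` is immune, there is a 1-generic `A` such that `A ∪ X` computes the halting set `K` in a way
that also refutes 1-genericity; hyperimmunity of the complement plays no role. `A` is a limit of
strings `σ₀, σ₁, …`. Fix a parity `r` such that `X` has infinitely many elements of parity `r`. At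
stage `s`, extend `σ = σ_s` by ones and then a zero at a position `p ∉ X` that codes `σ` and the bit
`K(s)`; since every code has infinitely many positions, immunity provides one outside `X`. Further
ones and a zero at `x` lead to a string `μ_x`. If for some `x ∈ X` no extension of `μ_x` lies in the
`s`-th c.e. set `W`, add this zero, which is invisible in `A ∪ X`, and then a zero at some `q ∉ X`
of the other parity. Otherwise the `x` of parity `r` for which `μ_x` has an extension in `W` form an
infinite c.e. set, so some such `x` is outside `X` (`exists_stage`); take the extension of `μ_x` that
a fixed search procedure finds. In both cases `W` is met or avoided. The parity of the second visible
zero of the stage tells which case has happened, and in the second case the search can be repeated,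
as `σ`, `p` and `x` are known. So the positions at which the stages begin, and with them the bits
`K(s)`, can be computed from initial segments of `A ∪ X` (`Stage.decode`), and `K` is Turing
reducible to `A ∪ X` (`setTuringReducible_of_initSeg`). Moreover the strings that code the bit `0`
for some `s ∈ K` form a c.e. set which no initial segment of `A ∪ X` meets, but every one can be
extended to meet, so `A ∪ X` is not 1-generic.

For finite `X`, a c.e. set `W` is handled by applying 1-genericity of `G` to the c.e. set of strings
`σ` with `σ ∪ X` in `W` (`isUnionSet_of_finite`).
-/

namespace Genericity

open Nat.Partrec (Code)

/-! ### Computably enumerable predicates -/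

section REPred

variable {α β : Type*} [Primcodable α] [Primcodable β]

theorem REPred.comp {p : β → Prop} (hp : REPred p) {f : α → β} (hf : Computable f) :
    REPred fun a => p (f a) :=
  Partrec.comp hp hf

theorem REPred.and {p q : α → Prop} (hp : REPred p) (hq : REPred q) :
    REPred fun a => p a ∧ q a := by
  have h : Partrec fun a => (Part.assert (p a) fun _ => Part.some ()).bind
      fun _ => Part.assert (q a) fun _ => Part.some () :=
    Partrec.bind hp (Partrec.comp hq Computable.fst).to₂
  exact h.dom_re.of_eq fun a => by simp [Part.dom_iff_mem]

theorem REPred.exists_code {p : α → Prop} (hp : REPred p) :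
    ∃ c : Code, ∀ a, p a ↔ (c.eval (Encodable.encode a)).Dom := by
  obtain ⟨c, hc⟩ := Code.exists_code.1 (Partrec.bind_decode₂_iff.1 hp)
  refine ⟨c, fun a => ?_⟩
  rw [hc]
  simp [Part.dom_iff_mem]

/-- Uniformization: a c.e. relation contains the graph of a partial computable function with the
same domain. It is found by running through all candidates and all numbers of steps. -/
theorem REPred.exists_uniformization {q : α × β → Prop} (hq : REPred q) :
    ∃ f : α →. β, Partrec f ∧ (∀ a, ∀ b ∈ f a, q (a, b)) ∧
      ∀ a, (f a).Dom ↔ ∃ b, q (a, b) := by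
  obtain ⟨c, hc⟩ := REPred.exists_code hq
  let F : α → ℕ → Option β := fun a n =>
    (Encodable.decode (α := β × ℕ) n).bind fun bk =>
      (Code.evaln bk.2 c (Encodable.encode (a, bk.1))).map fun _ => bk.1
  have hF : Computable₂ F := by
    refine Computable.option_bind (Computable.decode.comp Computable.snd) ?_
    refine Computable.option_map (Code.primrec_evaln.to_comp.comp
      (Computable.pair (Computable.pair (Computable.snd.comp Computable.snd)
        (Computable.const c)) (Computable.encode.comp (Computable.pair
          (Computable.fst.comp Computable.fst) (Computable.fst.comp Computable.snd))))) ?_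
    exact (Computable.fst.comp (Computable.snd.comp Computable.fst)).to₂
  have key : ∀ a b, (∃ n, b ∈ F a n) ↔ q (a, b) := by
    intro a b
    rw [hc, Part.dom_iff_mem]
    simp only [F, Code.evaln_complete, Option.mem_def, Option.bind_eq_some_iff,
      Option.map_eq_some_iff]
    constructor
    · rintro ⟨n, ⟨b', k⟩, -, y, hy, rfl⟩
      exact ⟨y, k, hy⟩
    · rintro ⟨y, k, hy⟩
      exact ⟨Encodable.encode (b, k), (b, k), Encodable.encodek _, y, hy, rfl⟩
  refine ⟨fun a => Nat.rfindOpt (F a), Partrec.rfindOpt hF,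
    fun a b hb => (key a b).1 (Nat.rfindOpt_spec hb), fun a => ?_⟩
  rw [Nat.rfindOpt_dom, exists_comm]
  exact exists_congr fun b => key a b

theorem REPred.exists {q : α × β → Prop} (hq : REPred q) :
    REPred fun a => ∃ b, q (a, b) := by
  obtain ⟨f, hf, -, h⟩ := REPred.exists_uniformization hq
  exact hf.dom_re.of_eq h

theorem REPred.mem_partrec [DecidableEq β] {f : α →. β} (hf : Partrec f) (b : β) :
    REPred fun a => b ∈ f a := by
  have hd : Computable fun c : β => decide (c = b) :=
    (Primrec.eq.comp Primrec.id (Primrec.const b)).decide.to_comp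
  have h : Partrec fun a => (f a).bind fun c => cond (decide (c = b)) (Part.some ()) Part.none :=
    hf.bind ((Partrec.cond hd (Computable.const ()).partrec Partrec.none).comp Computable.snd).to₂
  refine h.dom_re.of_eq fun a => ?_
  rw [Part.dom_iff_mem]
  simp only [Part.mem_bind_iff]
  constructor
  · rintro ⟨y, c, hc, hy⟩
    by_cases e : c = b
    · exact e ▸ hc
    · simp [e] at hy
  · intro hb
    exact ⟨(), b, hb, by simp⟩

end REPred

/-! ### Binary strings -/

open Classical in
/-- The initial segment of `B` of length `k`. -/
noncomputable def initSeg (B : Set ℕ) (k : ℕ) : List Bool :=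
  (List.range k).map fun i => decide (i ∈ B)

@[simp] theorem length_initSeg (B : Set ℕ) (k : ℕ) : (initSeg B k).length = k := by
  simp [initSeg]

theorem getD_initSeg {B : Set ℕ} {k i : ℕ} (h : i < k) :
    (initSeg B k).getD i true = true ↔ i ∈ B := by
  simp [initSeg, h]

theorem isInitialSegment_iff {σ : List Bool} {A : Set ℕ} :
    IsInitialSegment σ A ↔ ∀ i < σ.length, (σ.getD i true = true ↔ i ∈ A) := by
  refine forall₂_congr fun i hi => ?_
  simp [hi]

theorem isInitialSegment_initSeg (B : Set ℕ) (k : ℕ) : IsInitialSegment (initSeg B k) B :=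
  isInitialSegment_iff.2 fun i hi => getD_initSeg (by simpa using hi)

theorem getD_of_prefix {σ τ : List Bool} (h : σ <+: τ) {i : ℕ} (hi : i < σ.length) :
    τ.getD i true = σ.getD i true := by
  obtain ⟨ν, rfl⟩ := h
  simp [List.getElem?_append_left hi]

theorem prefix_of_getD {σ τ : List Bool} (hl : σ.length ≤ τ.length)
    (h : ∀ i < σ.length, τ.getD i true = σ.getD i true) : σ <+: τ := by
  rw [List.prefix_iff_eq_take]
  refine List.ext_getElem (by simpa using hl) fun i h₁ h₂ => ?_
  have := h i h₁
  simp only [List.getD_eq_getElem?_getD, List.getElem?_eq_getElem h₁,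
    List.getElem?_eq_getElem (h₁.trans_le hl), Option.getD_some] at this
  simp [this]

theorem IsInitialSegment.prefix {σ τ : List Bool} {A : Set ℕ} (hσ : IsInitialSegment σ A)
    (hτ : IsInitialSegment τ A) (hl : σ.length ≤ τ.length) : σ <+: τ := by
  rw [isInitialSegment_iff] at hσ hτ
  refine prefix_of_getD hl fun i hi => ?_
  rw [Bool.eq_iff_iff, hσ i hi, hτ i (hi.trans_le hl)]

/-- The string that extends `σ` by ones up to position `x`, where it has a zero, its last bit. It
is used for `σ.length ≤ x` only. -/
def pad (σ : List Bool) (x : ℕ) : List Bool :=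
  σ ++ ((List.range (x - σ.length)).map fun _ => true) ++ [false]

theorem length_pad {σ : List Bool} {x : ℕ} (h : σ.length ≤ x) : (pad σ x).length = x + 1 := by
  simp only [pad, List.length_append, List.length_map, List.length_range, List.length_singleton]
  omega

theorem prefix_pad (σ : List Bool) (x : ℕ) : σ <+: pad σ x :=
  ⟨_, (List.append_assoc _ _ _).symm⟩

theorem getD_pad {σ : List Bool} {x i : ℕ} (hx : σ.length ≤ x) (hi : σ.length ≤ i) :
    (pad σ x).getD i true = true ↔ i ≠ x := by
  rcases lt_trichotomy i x with h | rfl | h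
  · rw [pad, List.getD_append _ _ _ _ (by simp; omega), List.getD_append_right _ _ _ _ hi]
    simp [h.ne, show i - σ.length < x - σ.length by omega]
  · rw [pad, List.getD_append_right _ _ _ _ (by simp; omega)]
    simp [show i - (σ.length + (i - σ.length)) = 0 by omega]
  · rw [List.getD_eq_default _ _ (by rw [length_pad hx]; omega)]
    simp [h.ne']

theorem primrec_pad : Primrec₂ pad := by
  refine Primrec.list_append.comp₂ (Primrec.list_append.comp₂ Primrec₂.left ?_)
    (Primrec₂.const [false])
  exact Primrec.list_map (Primrec.list_range.comp (Primrec.nat_sub.comp Primrec.snd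
    (Primrec.list_length.comp Primrec.fst))) (Primrec.const true).to₂

theorem primrecPred_prefix : PrimrecPred fun p : List Bool × List Bool => p.1 <+: p.2 := by
  refine (Primrec.eq.comp Primrec.fst (Primrec.list_take.comp
    (Primrec.list_length.comp Primrec.fst) Primrec.snd)).of_eq fun p => ?_
  exact List.prefix_iff_eq_take.symm

/-! ### One-generic sets as limits of chains of strings -/

/-- The `s`-th c.e. set of binary strings. -/
def stringSet (s : ℕ) : Set (List Bool) :=
  {τ | ((Denumerable.ofNat Code s).eval (Encodable.encode τ)).Dom}

theorem exists_eq_stringSet {W : Set (List Bool)} (hW : REPred fun τ => τ ∈ W) :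
    ∃ s, W = stringSet s := by
  obtain ⟨c, hc⟩ := REPred.exists_code hW
  exact ⟨Encodable.encode c, Set.ext fun τ => by simpa [stringSet] using hc τ⟩

theorem exists_partrec_extension : ∃ f : ℕ × List Bool →. List Bool, Partrec f ∧
    (∀ a, ∀ τ ∈ f a, a.2 <+: τ ∧ τ ∈ stringSet a.1) ∧
      ∀ a, (f a).Dom ↔ ∃ τ, a.2 <+: τ ∧ τ ∈ stringSet a.1 := by
  have h : REPred fun p : (ℕ × List Bool) × List Bool =>
      p.1.2 <+: p.2 ∧ p.2 ∈ stringSet p.1.1 := by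
    refine REPred.and ?_ ?_
    · exact REPred.comp primrecPred_prefix.computablePred.to_re
        (Computable.pair (Computable.snd.comp Computable.fst) Computable.snd)
    · exact (Code.eval_part.comp ((Computable.ofNat Code).comp (Computable.fst.comp
        Computable.fst)) (Computable.encode.comp Computable.snd)).dom_re
  exact REPred.exists_uniformization h

/-- A partial computable choice of an extension of the given string in the given c.e. set. -/
noncomputable def selectExt : ℕ × List Bool →. List Bool := exists_partrec_extension.choose

theorem partrec_selectExt : Partrec selectExt := exists_partrec_extension.choose_spec.1

theorem prefix_of_mem_selectExt {s : ℕ} {μ τ : List Bool} (h : τ ∈ selectExt (s, μ)) : μ <+: τ :=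
  (exists_partrec_extension.choose_spec.2.1 _ τ h).1

theorem mem_stringSet_of_mem_selectExt {s : ℕ} {μ τ : List Bool} (h : τ ∈ selectExt (s, μ)) :
    τ ∈ stringSet s :=
  (exists_partrec_extension.choose_spec.2.1 _ τ h).2

theorem selectExt_dom {s : ℕ} {μ : List Bool} :
    (selectExt (s, μ)).Dom ↔ ∃ τ, μ <+: τ ∧ τ ∈ stringSet s :=
  exists_partrec_extension.choose_spec.2.2 _

/-- Finite extension: if every stage `s` can extend every string properly so as to meet or to avoid
the `s`-th c.e. set, then the stages have a 1-generic limit. -/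
theorem exists_oneGeneric_chain {P : ℕ → List Bool → List Bool → Prop}
    (hex : ∀ s σ, ∃ τ, P s σ τ)
    (hpre : ∀ s σ τ, P s σ τ → σ <+: τ ∧ σ.length < τ.length)
    (hdec : ∀ s σ τ, P s σ τ → τ ∈ stringSet s ∨ ∀ υ, τ <+: υ → υ ∉ stringSet s) :
    ∃ (A : Set ℕ) (f : ℕ → List Bool), OneGeneric A ∧ f 0 = [] ∧ (∀ s, s ≤ (f s).length) ∧
      (∀ s, IsInitialSegment (f s) A) ∧ ∀ s, P s (f s) (f (s + 1)) := by
  choose g hg using hex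
  let f : ℕ → List Bool := fun s => Nat.rec [] (fun s σ => g s σ) s
  have hf : ∀ s, P s (f s) (f (s + 1)) := fun s => hg s (f s)
  have hlen : ∀ s, s ≤ (f s).length := by
    intro s
    induction s with
    | zero => exact Nat.zero_le _
    | succ s ih => exact Nat.succ_le_of_lt (ih.trans_lt (hpre _ _ _ (hf s)).2)
  have hmono : ∀ {s t}, s ≤ t → f s <+: f t := by
    intro s t h
    induction h with
    | refl => exact List.prefix_refl _
    | step _ ih => exact ih.trans (hpre _ _ _ (hf _)).1
  let A : Set ℕ := {i | (f (i + 1)).getD i true = true}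
  have hA : ∀ s, IsInitialSegment (f s) A := by
    intro s
    rw [isInitialSegment_iff]
    intro i hi
    change _ ↔ (f (i + 1)).getD i true = true
    rcases le_total s (i + 1) with h | h
    · rw [getD_of_prefix (hmono h) hi]
    · rw [getD_of_prefix (hmono h) (hlen (i + 1))]
  refine ⟨A, f, fun W hW => ?_, rfl, hlen, hA, hf⟩
  obtain ⟨s, rfl⟩ := exists_eq_stringSet hW
  exact ⟨f (s + 1), hA (s + 1), hdec _ _ _ (hf s)⟩

theorem exists_oneGeneric : ∃ A : Set ℕ, OneGeneric A := by
  have hex : ∀ (s : ℕ) (σ : List Bool), ∃ τ, (σ <+: τ ∧ σ.length < τ.length) ∧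
      (τ ∈ stringSet s ∨ ∀ υ, τ <+: υ → υ ∉ stringSet s) := by
    intro s σ
    have hl : σ.length < (σ ++ [true]).length := by simp
    by_cases h : ∃ τ, σ ++ [true] <+: τ ∧ τ ∈ stringSet s
    · obtain ⟨τ, h₁, h₂⟩ := h
      exact ⟨τ, ⟨(List.prefix_append _ _).trans h₁, hl.trans_le h₁.length_le⟩, Or.inl h₂⟩
    · exact ⟨σ ++ [true], ⟨List.prefix_append _ _, hl⟩,
        Or.inr fun υ h₁ h₂ => h ⟨υ, h₁, h₂⟩⟩
  obtain ⟨A, -, hA, -⟩ :=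
    exists_oneGeneric_chain hex (fun _ _ _ h => h.1) (fun _ _ _ h => h.2)
  exact ⟨A, hA⟩

/-! ### Infinite sets that are not immune -/

/-- The characteristic function of a superset of an infinite c.e. set `W` has no initial segment
with a zero at an element of `W`, although every string extends to one with such a zero. -/
theorem not_oneGeneric_of_infinite_subset {B W : Set ℕ} (hW : REPred fun n => n ∈ W)
    (hinf : W.Infinite) (hsub : W ⊆ B) : ¬ OneGeneric B := by
  intro hB
  have hre : REPred fun τ : List Bool => ∃ i, τ.getD i true = false ∧ i ∈ W := by
    refine REPred.exists (q := fun p : List Bool × ℕ => p.1.getD p.2 true = false ∧ p.2 ∈ W)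
      (REPred.and ?_ (REPred.comp hW Computable.snd))
    exact (Primrec.eq.comp (Primrec.list_getD true) (Primrec.const false)).computablePred.to_re
  obtain ⟨σ, hσ, ⟨i, hi, hiW⟩ | h⟩ := hB {τ | ∃ i, τ.getD i true = false ∧ i ∈ W} hre
  · have hlt : i < σ.length := by
      by_contra hge
      rw [List.getD_eq_default _ _ (not_lt.1 hge)] at hi
      exact absurd hi (by simp)
    have := (isInitialSegment_iff.1 hσ i hlt).2 (hsub hiW)
    exact Bool.false_ne_true (hi.symm.trans this)
  · obtain ⟨i, hiW, hi⟩ := hinf.exists_gt σ.length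
    refine h (pad σ i) (prefix_pad σ i) ⟨i, ?_, hiW⟩
    rw [← Bool.not_eq_true, getD_pad hi.le hi.le]
    simp

/-! ### Finite sets -/

/-- A finite modification preserves 1-genericity: the strings `σ` with `σ ∪ X` in a given c.e. set
form a c.e. set, and beyond all elements of `X` every bit of `σ ∪ X` can be prescribed. -/
theorem isUnionSet_of_finite {X : Set ℕ} (hX : X.Finite) : IsUnionSet X := by
  classical
  intro G hG W hW
  let u : List Bool → List Bool := fun σ =>
    (List.range σ.length).map fun i => σ.getD i true || decide (i ∈ hX.toFinset.toList)
  have hul : ∀ σ, (u σ).length = σ.length := fun σ => by simp [u]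
  have hu : ∀ σ i, i < σ.length →
      ((u σ).getD i true = true ↔ σ.getD i true = true ∨ i ∈ X) := by
    intro σ i hi
    simp [u, hi]
  have hcomp : Computable u := by
    have hm : Primrec fun i : ℕ => decide (i ∈ hX.toFinset.toList) := by
      refine Primrec.of_eq (PrimrecPred.decide (PrimrecPred.of_eq
        (PrimrecRel.exists_mem_list (R := fun a b : ℕ => a = b) Primrec.eq |>.comp
          (Primrec.const hX.toFinset.toList) Primrec.id) fun i => ?_)) fun i => rfl
      simp
    exact (Primrec.list_map (Primrec.list_range.comp Primrec.list_length)
      (Primrec.or.comp₂ ((Primrec.list_getD true).comp₂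
        (Primrec.fst.to₂) Primrec₂.right) (hm.comp₂ Primrec₂.right))).to_comp
  have hinit : ∀ σ, IsInitialSegment σ G → IsInitialSegment (u σ) (G ∪ X) := by
    intro σ hσ
    rw [isInitialSegment_iff] at hσ ⊢
    intro i hi
    rw [hul] at hi
    rw [hu σ i hi, hσ i hi]
    rfl
  obtain ⟨σ, hσ, h⟩ := hG {σ | u σ ∈ W} (REPred.comp hW hcomp)
  rcases h with h | h
  · exact ⟨u σ, hinit σ hσ, Or.inl h⟩
  obtain ⟨N, hN⟩ := hX.bddAbove
  -- the initial segment has to be long enough to cover both `σ` and `X`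
  let μ := initSeg G (max σ.length (N + 1))
  have hμ : IsInitialSegment μ G := isInitialSegment_initSeg _ _
  have hμl : μ.length = max σ.length (N + 1) := length_initSeg _ _
  have hσμ : σ <+: μ := hσ.prefix hμ (by rw [hμl]; exact le_max_left _ _)
  refine ⟨u μ, hinit μ hμ, Or.inr fun τ hτ hτW => ?_⟩
  obtain ⟨ν, rfl⟩ := hτ
  refine h (μ ++ ν) (hσμ.trans (List.prefix_append _ _)) ?_
  have : u (μ ++ ν) = u μ ++ ν := by
    refine List.IsPrefix.eq_of_length (prefix_of_getD ?_ ?_) ?_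
    · simp [hul]
    · intro i hi
      have hi' : i < (μ ++ ν).length := by simpa [hul] using hi
      rw [Bool.eq_iff_iff]
      rcases lt_or_ge i μ.length with hlt | hge
      · rw [getD_of_prefix (List.prefix_append (u μ) ν) (by rwa [hul]), hu _ _ hlt]
        rw [hu _ _ hi', getD_of_prefix (List.prefix_append μ ν) hlt]
      · have hiX : i ∉ X := fun hiX => by
          have := hN hiX
          have := le_max_right σ.length (N + 1)
          omega
        rw [List.getD_append_right _ _ _ _ (by rwa [hul]), hul, hu _ _ hi',
          List.getD_append_right _ _ _ _ hge]
        simp [hiX]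
    · simp [hul]
  change u (μ ++ ν) ∈ W
  rwa [this]

/-! ### Turing reductions from computations on initial segments -/

open Classical in
theorem recursiveIn_initSeg (T : Set ℕ) :
    Nat.RecursiveIn {charFun T} fun k => Part.some (Encodable.encode (initSeg T k)) := by
  -- the bit `T(y)` is appended to the string coded by `i` in the input `⟨⟨a, ⟨y, i⟩⟩, T(y)⟩`
  let G : ℕ → ℕ := fun x => Encodable.encode
    (((Encodable.decode (α := List Bool) x.unpair.1.unpair.2.unpair.2).getD []) ++
      [decide (x.unpair.2 = 1)])
  have hG : Nat.RecursiveIn {charFun T} (fun x => Part.some (G x)) := by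
    have : Primrec G := by
      refine Primrec.encode.comp (Primrec.list_concat.comp (Primrec.option_getD.comp
        (Primrec.decode.comp ?_) (Primrec.const [])) ?_)
      · exact Primrec.snd.comp (Primrec.unpair.comp (Primrec.snd.comp (Primrec.unpair.comp
          (Primrec.fst.comp Primrec.unpair))))
      · exact (Primrec.eq.comp (Primrec.snd.comp Primrec.unpair) (Primrec.const 1)).decide
    exact RecursiveIn.iff_nat.1 this.computableIn.recursiveIn
  have hid : Nat.RecursiveIn {charFun T} (fun x => Part.some x) :=
    RecursiveIn.iff_nat.1 (ComputableIn.id (α := ℕ)).recursiveIn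
  have hy : Nat.RecursiveIn {charFun T} (fun x => Part.some x.unpair.2.unpair.1) :=
    RecursiveIn.iff_nat.1 (Primrec.fst.comp (Primrec.unpair.comp (Primrec.snd.comp
      Primrec.unpair))).computableIn.recursiveIn
  have hT : Nat.RecursiveIn {charFun T}
      (fun x => Part.some (if x.unpair.2.unpair.1 ∈ T then 1 else 0)) :=
    (Nat.RecursiveIn.comp (.oracle (charFun T) (Set.mem_singleton _)) hy).of_eq fun x =>
      (Part.bind_some _ _).trans (by simp [charFun, Set.indicator_apply])
  have hstep := Nat.RecursiveIn.comp hG (Nat.RecursiveIn.pair hid hT)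
  have hnil : Nat.RecursiveIn {charFun T}
      (fun _ => Part.some (Encodable.encode ([] : List Bool))) :=
    RecursiveIn.iff_nat.1 (ComputableIn.const (α := ℕ) _).recursiveIn
  have hin : Nat.RecursiveIn {charFun T} (fun k => Part.some (Nat.pair 0 k)) :=
    RecursiveIn.iff_nat.1 (Primrec₂.natPair.comp (Primrec.const 0)
      Primrec.id).computableIn.recursiveIn
  refine ((Nat.RecursiveIn.prec hnil hstep).comp hin).of_eq fun k => ?_
  simp only [Part.bind_eq_bind, Part.bind_some, Nat.unpair_pair]
  induction k with
  | zero => simp [initSeg]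
  | succ k ih =>
    simp only [ih, Part.bind_some]
    simp only [Part.map_eq_map, Part.map_some, Part.bind_some, seq_eq_bind_map, Part.bind_eq_bind,
      Nat.unpair_pair, G, Encodable.encodek, Option.getD_some]
    congr 2
    by_cases h : k ∈ T <;> simp [initSeg, List.range_succ, h]

open Classical in
/-- A partial computable `g` that, on initial segments of `T`, computes only correct values of the
characteristic function of `S`, and all values on long enough ones, reduces `S` to `T`. -/
theorem setTuringReducible_of_initSeg {S T : Set ℕ} {g : ℕ × List Bool →. Bool} (hg : Partrec g)
    (hsound : ∀ n k, ∀ b ∈ g (n, initSeg T k), b = decide (n ∈ S))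
    (hcomplete : ∀ n, ∃ k, (g (n, initSeg T k)).Dom) : SetTuringReducible S T := by
  obtain ⟨c, hc⟩ := Code.exists_code.1 (Partrec.bind_decode₂_iff.1 hg)
  have hc' : ∀ n ρ y, y ∈ c.eval (Nat.pair n (Encodable.encode ρ)) ↔
      ∃ b ∈ g (n, ρ), Encodable.encode b = y := by
    intro n ρ y
    have e : Nat.pair n (Encodable.encode ρ) = Encodable.encode (n, ρ) := rfl
    rw [hc, e]
    simp only [Encodable.encodek₂, Part.coe_some, Part.bind_some, Part.mem_map_iff]
  -- `E ⟨⟨n, ⟨k, m⟩⟩, w⟩` is the code of the result of `m` steps of the computation of `g (n, w)`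
  let E : ℕ → ℕ := fun x =>
    Encodable.encode (Code.evaln x.unpair.1.unpair.2.unpair.2 c
      (Nat.pair x.unpair.1.unpair.1 x.unpair.2))
  have hE : Primrec E := by
    refine Primrec.encode.comp (Code.primrec_evaln.comp (Primrec.pair (Primrec.pair ?_
      (Primrec.const c)) (Primrec₂.natPair.comp ?_ (Primrec.snd.comp Primrec.unpair))))
    · exact Primrec.snd.comp (Primrec.unpair.comp (Primrec.snd.comp (Primrec.unpair.comp
        (Primrec.fst.comp Primrec.unpair))))
    · exact Primrec.fst.comp (Primrec.unpair.comp (Primrec.fst.comp Primrec.unpair))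
  let R : ℕ → ℕ := fun x => E (Nat.pair x (Encodable.encode (initSeg T x.unpair.2.unpair.1)))
  have hid : Nat.RecursiveIn {charFun T} (fun x => Part.some x) :=
    RecursiveIn.iff_nat.1 (ComputableIn.id (α := ℕ)).recursiveIn
  have hk : Nat.RecursiveIn {charFun T} (fun x => Part.some x.unpair.2.unpair.1) :=
    RecursiveIn.iff_nat.1 (Primrec.fst.comp (Primrec.unpair.comp (Primrec.snd.comp
      Primrec.unpair))).computableIn.recursiveIn
  have hR : Nat.RecursiveIn {charFun T} (fun x => Part.some (R x)) := by
    refine (Nat.RecursiveIn.comp (RecursiveIn.iff_nat.1 hE.computableIn.recursiveIn)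
      (Nat.RecursiveIn.pair hid ((recursiveIn_initSeg T).comp hk))).of_eq fun x => ?_
    simp [R, seq_eq_bind_map]
  have hpost : ∀ {f : ℕ → ℕ}, Primrec f → Nat.RecursiveIn {charFun T} (fun x => Part.some (f x)) :=
    fun hf => RecursiveIn.iff_nat.1 hf.computableIn.recursiveIn
  have hfind := Nat.RecursiveIn.rfind ((hpost (Primrec.nat_sub.comp (Primrec.const 1)
    Primrec.id)).comp hR)
  have hfin := (hpost Primrec.pred).comp (hR.comp (Nat.RecursiveIn.pair hid hfind))
  have hRpos : ∀ n j, R (Nat.pair n j) ≠ 0 →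
      R (Nat.pair n j) = Encodable.encode (decide (n ∈ S)) + 1 := by
    intro n j hj
    simp only [R, E, Nat.unpair_pair] at hj ⊢
    rcases h : Code.evaln j.unpair.2 c
      (Nat.pair n (Encodable.encode (initSeg T j.unpair.1))) with - | y
    · simp [h] at hj
    · obtain ⟨b, hb, rfl⟩ := (hc' _ _ _).1 (Code.evaln_sound h)
      rw [hsound _ _ _ hb]
      rfl
  have hRex : ∀ n, ∃ j, R (Nat.pair n j) ≠ 0 := by
    intro n
    obtain ⟨k, hk⟩ := hcomplete n
    obtain ⟨b, hb⟩ := Part.dom_iff_mem.1 hk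
    obtain ⟨m, hm⟩ := Code.evaln_complete.1 ((hc' n (initSeg T k) _).2 ⟨b, hb, rfl⟩)
    refine ⟨Nat.pair k m, ?_⟩
    simp only [R, E, Nat.unpair_pair]
    rw [Option.mem_def.1 hm]
    simp
  change RecursiveIn _ _
  rw [RecursiveIn.iff_nat]
  refine hfin.of_eq fun n => ?_
  obtain ⟨j, hj⟩ := Part.dom_iff_mem.1 (Nat.rfind_dom'
    (p := fun j => Part.some (decide (1 - R (Nat.pair n j) = 0))) |>.2 (by
      obtain ⟨j, hj⟩ := hRex n
      exact ⟨j, by simp; omega, fun _ => trivial⟩))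
  have hj0 : R (Nat.pair n j) ≠ 0 := by
    have := Nat.rfind_spec hj
    simp at this
    omega
  have hj' := Part.eq_some_iff.2 hj
  simp only [Part.bind_eq_bind, Part.bind_some, Part.map_eq_map, Part.map_some, seq_eq_bind_map,
    id_eq, hj']
  rw [hRpos n j hj0]
  by_cases h : n ∈ S <;> simp [charFun, h]

/-! ### Decoding -/

/-- The position of the first zero of `ρ` at or after position `l`. -/
def firstZero (ρ : List Bool) (l : ℕ) : Part ℕ :=
  (Nat.rfind fun k => Part.some (!(ρ.getD (l + k) true))).map fun k => l + k

theorem mem_firstZero {ρ : List Bool} {l p : ℕ} : p ∈ firstZero ρ l ↔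
    l ≤ p ∧ ρ.getD p true = false ∧ ∀ i, l ≤ i → i < p → ρ.getD i true = true := by
  rw [firstZero, Part.mem_map_iff]
  constructor
  · rintro ⟨k, hk, rfl⟩
    obtain ⟨h₁, h₂⟩ := Nat.mem_rfind.1 hk
    rw [Part.mem_some_iff] at h₁
    refine ⟨Nat.le_add_right _ _, by rw [← Bool.not_eq_true', ← h₁], fun i hi hik => ?_⟩
    have h := h₂ (m := i - l) (by omega)
    rw [Part.mem_some_iff, show l + (i - l) = i by omega] at h
    rw [← Bool.not_eq_false', ← h]
  · rintro ⟨h₁, h₂, h₃⟩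
    refine ⟨p - l, Nat.mem_rfind.2 ⟨?_, fun {m} hm => ?_⟩, by omega⟩
    · rw [Part.mem_some_iff, show l + (p - l) = p by omega, h₂]
      rfl
    · rw [Part.mem_some_iff, h₃ (l + m) (by omega) (by omega)]
      rfl

theorem firstZero_mono {ρ ρ' : List Bool} (h : ρ <+: ρ') {l p : ℕ} (hp : p ∈ firstZero ρ l) :
    p ∈ firstZero ρ' l := by
  rw [mem_firstZero] at hp ⊢
  obtain ⟨h₁, h₂, h₃⟩ := hp
  have hlt : p < ρ.length := by
    by_contra hge
    rw [List.getD_eq_default _ _ (not_lt.1 hge)] at h₂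
    exact absurd h₂ (by simp)
  exact ⟨h₁, by rw [getD_of_prefix h hlt, h₂], fun i hi hip => by
    rw [getD_of_prefix h (hip.trans hlt), h₃ i hi hip]⟩

theorem partrec_firstZero : Partrec₂ firstZero := by
  refine Partrec.map (Partrec.rfind (p := fun (a : List Bool × ℕ) k =>
    Part.some (!(a.1.getD (a.2 + k) true))) (Computable.partrec ?_)) ?_
  · exact (Primrec.not.comp ((Primrec.list_getD true).comp (Primrec.fst.comp Primrec.fst)
      (Primrec.nat_add.comp (Primrec.snd.comp Primrec.fst) Primrec.snd))).to_comp
  · exact (Primrec.nat_add.comp (Primrec.snd.comp Primrec.fst) Primrec.snd).to_comp.to₂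

/-- The string and the bit coded by a position. Every string and bit is coded by infinitely many
positions. -/
def color (p : ℕ) : List Bool × Bool :=
  ((Encodable.decode p.unpair.1 : Option (List Bool × Bool))).getD ([], false)

theorem primrec_color : Primrec color :=
  Primrec.option_getD.comp (Primrec.decode.comp (Primrec.fst.comp Primrec.unpair))
    (Primrec.const _)

theorem infinite_color (c : List Bool × Bool) : {p | color p = c}.Infinite := by
  refine Set.infinite_of_injective_forall_mem (f := fun k => Nat.pair (Encodable.encode c) k)
    (fun a b h => (Nat.pair_eq_pair.1 h).2) fun k => ?_
  change color _ = c
  rw [color, Nat.unpair_pair, Encodable.encodek, Option.getD_some]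

/-- The decoding of one stage, read off a string `ρ`. The first zero `p` from position `l` on codes
the string constructed so far, and the parity of the next zero tells whether the stage has chosen an
extension in the `s`-th c.e. set; if so, the search for it can be repeated. The value is the position
at which the next stage begins. -/
noncomputable def nextPos (r : ℕ) (ρ : List Bool) (s l : ℕ) : Part ℕ :=
  (firstZero ρ l).bind fun p => (firstZero ρ (p + 1)).bind fun q =>
    cond (decide (q % 2 = r))
      ((selectExt (s, pad (pad (color p).1 p) q)).map List.length) (Part.some (q + 1))

/-- The position at which stage `s` begins, decoded from `ρ`. -/
noncomputable def stagePos (r : ℕ) (ρ : List Bool) (s : ℕ) : Part ℕ :=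
  Nat.rec (Part.some 0) (fun s l => l.bind (nextPos r ρ s)) s

/-- The bit coded at stage `s`, decoded from `ρ`. -/
noncomputable def decodeBit (r : ℕ) (a : ℕ × List Bool) : Part Bool :=
  (stagePos r a.2 a.1).bind fun l => (firstZero a.2 l).map fun p => (color p).2

theorem partrec_decodeBit (r : ℕ) : Partrec (decodeBit r) := by
  have hsel : Partrec fun a : (ℕ × ℕ) × ℕ =>
      (selectExt (a.1.1, pad (pad (color a.1.2).1 a.1.2) a.2)).map List.length := by
    refine Partrec.map (partrec_selectExt.comp ?_) (Computable.list_length.comp Computable.snd).to₂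
    have hp : Primrec fun a : (ℕ × ℕ) × ℕ => a.1.2 := Primrec.snd.comp Primrec.fst
    have hc : Primrec fun a : (ℕ × ℕ) × ℕ => (color a.1.2).1 :=
      Primrec.fst.comp (primrec_color.comp hp)
    exact (Primrec.pair (Primrec.fst.comp Primrec.fst)
      (primrec_pad.comp (primrec_pad.comp hc hp) Primrec.snd)).to_comp
  have hcond : Partrec fun a : (ℕ × ℕ) × ℕ => cond (decide (a.2 % 2 = r))
      ((selectExt (a.1.1, pad (pad (color a.1.2).1 a.1.2) a.2)).map List.length)
      (Part.some (a.2 + 1)) :=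
    Partrec.cond (Primrec.eq.comp (Primrec.nat_mod.comp Primrec.snd (Primrec.const 2))
      (Primrec.const r)).decide.to_comp hsel (Computable.succ.comp Computable.snd).partrec
  have hnext : Partrec fun a : List Bool × ℕ × ℕ => nextPos r a.1 a.2.1 a.2.2 := by
    have h₁ : Partrec fun a : List Bool × ℕ × ℕ => firstZero a.1 a.2.2 :=
      partrec_firstZero.comp Computable.fst (Computable.snd.comp Computable.snd)
    have h₂ : Partrec fun a : (List Bool × ℕ × ℕ) × ℕ => firstZero a.1.1 (a.2 + 1) :=
      have hl : Computable fun a : (List Bool × ℕ × ℕ) × ℕ => a.2 + 1 :=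
        Computable.succ.comp Computable.snd
      have hρ : Computable fun a : (List Bool × ℕ × ℕ) × ℕ => a.1.1 :=
        Computable.fst.comp Computable.fst
      partrec_firstZero.comp hρ hl
    have hsp : Computable fun a : ((List Bool × ℕ × ℕ) × ℕ) × ℕ =>
        ((a.1.1.2.1, a.1.2), a.2) :=
      ((((Computable.fst.comp Computable.snd).comp Computable.fst).comp Computable.fst).pair
        (Computable.snd.comp Computable.fst)).pair Computable.snd
    exact h₁.bind (h₂.bind (hcond.comp hsp).to₂).to₂
  have hstage : Partrec fun a : ℕ × List Bool => stagePos r a.2 a.1 := by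
    have hsp : Computable fun a : (ℕ × List Bool) × ℕ × ℕ => (a.1.2, a.2.1, a.2.2) :=
      (Computable.snd.comp Computable.fst).pair Computable.snd
    have h₀ : Partrec fun _ : ℕ × List Bool => Part.some 0 := (Computable.const 0).partrec
    exact Partrec.nat_rec Computable.fst h₀ (hnext.comp hsp).to₂
  refine Partrec.bind hstage (Partrec.map (partrec_firstZero.comp
    (Computable.snd.comp Computable.fst) Computable.snd) ?_)
  exact (Primrec.snd.comp (primrec_color.comp Primrec.snd)).to_comp.to₂

theorem stagePos_mono {r : ℕ} {ρ ρ' : List Bool} (h : ρ <+: ρ') {s l : ℕ}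
    (hl : l ∈ stagePos r ρ s) : l ∈ stagePos r ρ' s := by
  induction s generalizing l with
  | zero => exact hl
  | succ s ih =>
    obtain ⟨m, hm, hl⟩ := Part.mem_bind_iff.1 hl
    obtain ⟨p, hp, hl⟩ := Part.mem_bind_iff.1 hl
    obtain ⟨q, hq, hl⟩ := Part.mem_bind_iff.1 hl
    exact Part.mem_bind_iff.2 ⟨m, ih hm, Part.mem_bind_iff.2 ⟨p, firstZero_mono h hp,
      Part.mem_bind_iff.2 ⟨q, firstZero_mono h hq, hl⟩⟩⟩

theorem decodeBit_mono {r : ℕ} {ρ ρ' : List Bool} (h : ρ <+: ρ') {s : ℕ} {b : Bool}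
    (hb : b ∈ decodeBit r (s, ρ)) : b ∈ decodeBit r (s, ρ') := by
  obtain ⟨l, hl, hb⟩ := Part.mem_bind_iff.1 hb
  obtain ⟨p, hp, hb⟩ := (Part.mem_map_iff _).1 hb
  exact Part.mem_bind_iff.2 ⟨l, stagePos_mono h hl,
    (Part.mem_map_iff _).2 ⟨p, firstZero_mono h hp, hb⟩⟩

/-! ### The construction for immune sets -/

theorem Immune.exists_notMem {X : Set ℕ} (hX : Immune X) {W : Set ℕ}
    (hW : REPred fun n => n ∈ W) (hinf : W.Infinite) (l : ℕ) : ∃ p, l < p ∧ p ∈ W ∧ p ∉ X := by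
  have hre : REPred fun p => p ∈ W ∩ {p | l < p} :=
    REPred.and hW (Primrec.nat_lt.comp (Primrec.const l) Primrec.id).computablePred.to_re
  have hinf' : (W ∩ {p | l < p}).Infinite := by
    refine Set.infinite_of_forall_exists_gt fun a => ?_
    obtain ⟨p, hp, h⟩ := hinf.exists_gt (max a l)
    exact ⟨p, ⟨hp, (le_max_right _ _).trans_lt h⟩, (le_max_left _ _).trans_lt h⟩
  obtain ⟨p, ⟨hp, hlp⟩, hpX⟩ := Set.not_subset.1 (hX.2 _ hre hinf')
  exact ⟨p, hlp, hp, hpX⟩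

/-- `Stage X r b s σ τ`: stage `s` may extend `σ` to `τ`. The position `p` of the first zero after
`σ` codes `σ` and `b`. Either an extension in the `s`-th c.e. set is then ruled out by a zero at some
`x ∈ X`, which does not show in the union with `X`, and the next zero that does show has a parity
other than `r`; or the next zero `x` has parity `r` and `τ` is the chosen extension in the `s`-th
c.e. set. -/
def Stage (X : Set ℕ) (r : ℕ) (b : Bool) (s : ℕ) (σ τ : List Bool) : Prop :=
  ∃ p x, σ.length ≤ p ∧ p < x ∧ p ∉ X ∧ color p = (σ, b) ∧
    ((x ∈ X ∧ ¬ (selectExt (s, pad (pad σ p) x)).Dom ∧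
        ∃ q, x < q ∧ q ∉ X ∧ q % 2 ≠ r ∧ τ = pad (pad (pad σ p) x) q) ∨
      (x ∉ X ∧ x % 2 = r ∧ τ ∈ selectExt (s, pad (pad σ p) x)))

/-- If zeros at all `x ∈ X` of parity `r` allow for an extension in the `s`-th c.e. set, then so do
zeros at infinitely many positions forming a c.e. set; by immunity one of them is outside `X`. -/
theorem exists_stage {X : Set ℕ} (hX : Immune X) {r : ℕ} (hr : (X ∩ {x | x % 2 = r}).Infinite)
    (b : Bool) (s : ℕ) (σ : List Bool) : ∃ τ, Stage X r b s σ τ := by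
  obtain ⟨p, hp, hpc, hpX⟩ := hX.exists_notMem (W := {p | color p = (σ, b)})
    (Primrec.eq.comp primrec_color (Primrec.const _)).computablePred.to_re
    (infinite_color (σ, b)) σ.length
  by_cases h : ∃ x ∈ X, p < x ∧ ¬ (selectExt (s, pad (pad σ p) x)).Dom
  · obtain ⟨x, hxX, hpx, hx⟩ := h
    obtain ⟨q, hxq, hq, hqX⟩ := hX.exists_notMem (W := {q | q % 2 ≠ r})
      (PrimrecPred.not (Primrec.eq.comp (Primrec.nat_mod.comp Primrec.id (Primrec.const 2))
        (Primrec.const r))).computablePred.to_re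
      (Set.infinite_of_forall_exists_gt fun a => by
        by_cases ha : (a + 1) % 2 = r
        · exact ⟨a + 2, show (a + 2) % 2 ≠ r by omega, by omega⟩
        · exact ⟨a + 1, ha, by omega⟩) x
    exact ⟨_, p, x, hp.le, hpx, hpX, hpc, Or.inl ⟨hxX, hx, q, hxq, hqX, hq, rfl⟩⟩
  · push Not at h
    obtain ⟨x, hpx, ⟨hxr, hx⟩, hxX⟩ := hX.exists_notMem
      (W := {x | x % 2 = r ∧ (selectExt (s, pad (pad σ p) x)).Dom})
      (REPred.and (Primrec.eq.comp (Primrec.nat_mod.comp Primrec.id (Primrec.const 2))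
        (Primrec.const r)).computablePred.to_re
        (partrec_selectExt.comp (Primrec.pair (Primrec.const s) (primrec_pad.comp
          (Primrec.const (pad σ p)) Primrec.id)).to_comp).dom_re)
      (Set.infinite_of_forall_exists_gt fun a => by
        obtain ⟨x, ⟨hxX, hxr⟩, hx⟩ := hr.exists_gt (max a p)
        exact ⟨x, ⟨hxr, h x hxX ((le_max_right _ _).trans_lt hx)⟩,
          (le_max_left _ _).trans_lt hx⟩) p
    obtain ⟨τ, hτ⟩ := Part.dom_iff_mem.1 hx
    exact ⟨τ, p, x, hp.le, hpx, hpX, hpc, Or.inr ⟨hxX, hxr, hτ⟩⟩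

namespace Stage

variable {X : Set ℕ} {r s : ℕ} {b : Bool} {σ τ : List Bool}

theorem prefix_and_length_lt (h : Stage X r b s σ τ) : σ <+: τ ∧ σ.length < τ.length := by
  obtain ⟨p, x, hp, hpx, -, -, h⟩ := h
  have hpre : pad (pad σ p) x <+: τ := by
    rcases h with ⟨-, -, q, -, -, -, rfl⟩ | ⟨-, -, h⟩
    · exact prefix_pad _ _
    · exact prefix_of_mem_selectExt h
  refine ⟨(prefix_pad _ _).trans ((prefix_pad _ _).trans hpre), ?_⟩
  have := hpre.length_le
  rw [length_pad (by rw [length_pad hp]; omega)] at this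
  omega

theorem decides (h : Stage X r b s σ τ) :
    τ ∈ stringSet s ∨ ∀ υ, τ <+: υ → υ ∉ stringSet s := by
  obtain ⟨p, x, -, -, -, -, ⟨-, hx, q, -, -, -, rfl⟩ | ⟨-, -, h⟩⟩ := h
  · exact Or.inr fun υ hυ hυs => hx (selectExt_dom.2 ⟨υ, (prefix_pad _ _).trans hυ, hυs⟩)
  · exact Or.inl (mem_stringSet_of_mem_selectExt h)

/-- A string that agrees with `τ ∪ X` as far as `τ` reaches allows for decoding the stage. -/
theorem decode (h : Stage X r b s σ τ) {ρ : List Bool}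
    (hρ : ∀ i < τ.length, (ρ.getD i true = true ↔ τ.getD i true = true ∨ i ∈ X)) :
    τ.length ∈ nextPos r ρ s σ.length ∧
      ∃ p ∈ firstZero ρ σ.length, (color p).2 = b := by
  obtain ⟨p, x, hp, hpx, hpX, hc, h⟩ := h
  have hl₁ : (pad σ p).length = p + 1 := length_pad hp
  have hl₂ : (pad (pad σ p) x).length = x + 1 := length_pad (by omega)
  have hpre : pad (pad σ p) x <+: τ := by
    rcases h with ⟨-, -, q, -, -, -, rfl⟩ | ⟨-, -, h⟩
    · exact prefix_pad _ _
    · exact prefix_of_mem_selectExt h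
  have hτl : x + 1 ≤ τ.length := hl₂ ▸ hpre.length_le
  -- between the end of `σ` and `x` the only zero is at `p`
  have hτ₁ : ∀ i, σ.length ≤ i → i ≤ p → (τ.getD i true = true ↔ i ≠ p) := fun i hi hip => by
    rw [getD_of_prefix hpre (by omega), getD_of_prefix (prefix_pad _ _) (by omega), getD_pad hp hi]
  have hτ₂ : ∀ i, p < i → i ≤ x → (τ.getD i true = true ↔ i ≠ x) := fun i hi hix => by
    rw [getD_of_prefix hpre (by omega), getD_pad (by omega) (by omega)]
  have hpz : p ∈ firstZero ρ σ.length := by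
    refine mem_firstZero.2 ⟨hp, ?_, fun i hi hip => ?_⟩
    · rw [← Bool.not_eq_true, hρ p (by omega), hτ₁ p hp le_rfl]
      tauto
    · rw [hρ i (by omega), hτ₁ i hi hip.le]
      exact Or.inl hip.ne
  refine ⟨Part.mem_bind_iff.2 ⟨p, hpz, ?_⟩, p, hpz, by rw [hc]⟩
  rw [hc]
  rcases h with ⟨hxX, -, q, hxq, hqX, hqr, rfl⟩ | ⟨hxX, hxr, h⟩
  · have hl₃ : (pad (pad (pad σ p) x) q).length = q + 1 := length_pad (by omega)
    have hτ₃ : ∀ i, x < i → ((pad (pad (pad σ p) x) q).getD i true = true ↔ i ≠ q) :=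
      fun i hi => getD_pad (by omega) (by omega)
    refine Part.mem_bind_iff.2 ⟨q, mem_firstZero.2 ⟨by omega, ?_, fun i hi hiq => ?_⟩, ?_⟩
    · rw [← Bool.not_eq_true, hρ q (by omega), hτ₃ q hxq]
      tauto
    · rw [hρ i (by omega)]
      rcases lt_trichotomy i x with hix | rfl | hix
      · exact Or.inl ((hτ₂ i (by omega) hix.le).2 hix.ne)
      · exact Or.inr hxX
      · exact Or.inl ((hτ₃ i hix).2 hiq.ne)
    · simp [hqr, hl₃]
  · refine Part.mem_bind_iff.2 ⟨x, mem_firstZero.2 ⟨by omega, ?_, fun i hi hix => ?_⟩, ?_⟩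
    · rw [← Bool.not_eq_true, hρ x (by omega), hτ₂ x hpx le_rfl]
      tauto
    · rw [hρ i (by omega), hτ₂ i (by omega) hix.le]
      exact Or.inl hix.ne
    · simp only [hxr, decide_true, cond_true]
      exact Part.mem_map _ h

end Stage

theorem infinite_haltingSet : haltingSet.Infinite := by
  refine Set.infinite_of_injective_forall_mem (f := fun n => Encodable.encode (Code.const n))
    (fun a b h => Code.const_inj (Encodable.encode_injective h)) fun n => ?_
  simp [haltingSet]

theorem rePred_haltingSet : REPred fun e => e ∈ haltingSet :=
  (Code.eval_part.comp (Computable.ofNat Code) Computable.id).dom_re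

open Classical in
theorem Immune.exists_oneGeneric_union_computes_haltingSet {X : Set ℕ} (hX : Immune X) :
    ∃ A : Set ℕ, OneGeneric A ∧ ¬ OneGeneric (A ∪ X) ∧
      SetTuringReducible haltingSet (A ∪ X) := by
  obtain ⟨r, hr⟩ : ∃ r, (X ∩ {x | x % 2 = r}).Infinite := by
    by_contra! h
    refine hX.1 (((h 0).union (h 1)).subset fun x hx => ?_)
    rcases Nat.mod_two_eq_zero_or_one x with h₀ | h₁
    · exact Or.inl ⟨hx, h₀⟩
    · exact Or.inr ⟨hx, h₁⟩
  obtain ⟨A, f, hA, hf₀, hlen, hinit, hstage⟩ := exists_oneGeneric_chain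
    (P := fun s σ τ => Stage X r (decide (s ∈ haltingSet)) s σ τ)
    (fun s σ => exists_stage hX hr _ s σ) (fun _ _ _ h => h.prefix_and_length_lt)
    (fun _ _ _ h => h.decides)
  have hagree : ∀ s i, i < (f s).length → ((f s).getD i true = true ∨ i ∈ X ↔ i ∈ A ∪ X) :=
    fun s i hi => or_congr (isInitialSegment_iff.1 (hinit s) i hi) Iff.rfl
  have hpos : ∀ s ρ, (∀ i < (f s).length, (ρ.getD i true = true ↔ i ∈ A ∪ X)) →
      (f s).length ∈ stagePos r ρ s := by
    intro s
    induction s with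
    | zero =>
      intro ρ _
      rw [hf₀]
      exact Part.mem_some _
    | succ s ih =>
      intro ρ hρ
      refine Part.mem_bind_iff.2 ⟨_, ih ρ fun i hi => hρ i
        (hi.trans (hstage s).prefix_and_length_lt.2), ((hstage s).decode fun i hi => ?_).1⟩
      rw [hρ i hi, hagree _ _ hi]
  have hbit : ∀ s k, (f (s + 1)).length ≤ k →
      decide (s ∈ haltingSet) ∈ decodeBit r (s, initSeg (A ∪ X) k) := by
    intro s k hk
    have hρ : ∀ i < (f (s + 1)).length,
        ((initSeg (A ∪ X) k).getD i true = true ↔ i ∈ A ∪ X) :=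
      fun i hi => getD_initSeg (hi.trans_le hk)
    obtain ⟨p, hp, hpb⟩ := ((hstage s).decode fun i hi => by rw [hρ i hi, hagree _ _ hi]).2
    exact Part.mem_bind_iff.2 ⟨_, hpos s _ fun i hi => hρ i
      (hi.trans (hstage s).prefix_and_length_lt.2), (Part.mem_map_iff _).2 ⟨p, hp, hpb⟩⟩
  have hsound : ∀ s ρ, IsInitialSegment ρ (A ∪ X) → ∀ b ∈ decodeBit r (s, ρ),
      b = decide (s ∈ haltingSet) := by
    intro s ρ hρ b hb
    have hpre : ρ <+: initSeg (A ∪ X) (max ρ.length (f (s + 1)).length) :=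
      hρ.prefix (isInitialSegment_initSeg _ _) (by simp)
    exact Part.mem_unique (decodeBit_mono hpre hb) (hbit s _ (le_max_right _ _))
  refine ⟨A, hA, fun hB => ?_, setTuringReducible_of_initSeg (partrec_decodeBit r)
    (fun n k => hsound n _ (isInitialSegment_initSeg _ _))
    fun n => ⟨_, Part.dom_iff_mem.2 ⟨_, hbit n _ le_rfl⟩⟩⟩
  -- no initial segment of `A ∪ X` falsely codes that some `s` is outside the halting set
  have hre : REPred fun ρ => ∃ s, s ∈ haltingSet ∧ false ∈ decodeBit r (s, ρ) := by
    refine REPred.exists (q := fun a : List Bool × ℕ =>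
      a.2 ∈ haltingSet ∧ false ∈ decodeBit r (a.2, a.1)) (REPred.and
        (REPred.comp rePred_haltingSet Computable.snd) (REPred.comp
          (REPred.mem_partrec (partrec_decodeBit r) false)
          (Computable.pair Computable.snd Computable.fst)))
  obtain ⟨σ, hσ, ⟨s, hs, hb⟩ | h⟩ :=
    hB {ρ | ∃ s, s ∈ haltingSet ∧ false ∈ decodeBit r (s, ρ)} hre
  · simpa [hs] using hsound s σ hσ _ hb
  · -- but every initial segment extends to a string that does
    obtain ⟨s, hs, hσs⟩ := infinite_haltingSet.exists_gt σ.length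
    let μ := initSeg (A ∪ X) (f s).length
    have hμl : μ.length = (f s).length := length_initSeg _ _
    obtain ⟨p, hpc, hp⟩ := (infinite_color ([], false)).exists_gt μ.length
    have hσμ : σ <+: μ := hσ.prefix (isInitialSegment_initSeg _ _)
      (by rw [hμl]; exact hσs.le.trans (hlen s))
    refine h (pad μ p) (hσμ.trans (prefix_pad _ _)) ⟨s, hs, Part.mem_bind_iff.2
      ⟨(f s).length, hpos s _ fun i hi => ?_, (Part.mem_map_iff _).2 ⟨p, mem_firstZero.2
        ⟨hμl ▸ hp.le, ?_, fun i hi hip => ?_⟩, by rw [hpc]⟩⟩⟩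
    · rw [getD_of_prefix (prefix_pad _ _) (by omega)]
      exact getD_initSeg hi
    · rw [← Bool.not_eq_true, getD_pad hp.le hp.le]
      simp
    · exact (getD_pad hp.le (by omega)).2 hip.ne

theorem exists_oneGeneric_union_not_oneGeneric {X : Set ℕ} (hX : X.Infinite) :
    ∃ A : Set ℕ, OneGeneric A ∧ ¬ OneGeneric (A ∪ X) := by
  by_cases h : Immune X
  · obtain ⟨A, hA, hAX, -⟩ := h.exists_oneGeneric_union_computes_haltingSet
    exact ⟨A, hA, hAX⟩
  · have : ∃ W : Set ℕ, REPred (fun n : ℕ => n ∈ W) ∧ W.Infinite ∧ W ⊆ X := by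
      by_contra! h'
      exact h ⟨hX, h'⟩
    obtain ⟨W, hW, hinf, hWX⟩ := this
    obtain ⟨A, hA⟩ := exists_oneGeneric
    exact ⟨A, hA, not_oneGeneric_of_infinite_subset hW hinf
      (hWX.trans Set.subset_union_right)⟩

end Genericity

theorem mainTheorem1 :
    (∀ X : Set ℕ, X.Infinite →
      ∃ A : Set ℕ, Genericity.OneGeneric A ∧ ¬ Genericity.OneGeneric (A ∪ X)) ∧
    (¬ ∃ X : Set ℕ, X.Infinite ∧ Genericity.IsUnionSet X) ∧
    (∀ X : Set ℕ, X.Finite → Genericity.IsUnionSet X) ∧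
    (∀ X : Set ℕ, Genericity.Immune X → ¬ Genericity.Hyperimmune Xᶜ →
      ∃ A : Set ℕ, Genericity.OneGeneric A ∧ ¬ Genericity.OneGeneric (A ∪ X) ∧
        Genericity.SetTuringReducible Genericity.haltingSet (A ∪ X)) := by
  refine ⟨fun X hX => Genericity.exists_oneGeneric_union_not_oneGeneric hX, ?_,
    fun X hX => Genericity.isUnionSet_of_finite hX,
    fun X hX _ => hX.exists_oneGeneric_union_computes_haltingSet⟩
  rintro ⟨X, hX, hU⟩
  obtain ⟨A, hA, hAX⟩ := Genericity.exists_oneGeneric_union_not_oneGeneric hX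
  exact hAX (hU A hA)
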